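/- Let $k$ be an infinite field. A function $h=(h_0,h_1,h_2,\dots)$ is called a Gorenstein $h$-vector of codimension $r$ and socle degree $e$ if there is a homogeneous ideal $I\subset R=k[x_1,\dots,x_r]$ (standard grading) such that $A=R/I$ is artinian and Gorenstein, i.e. the socle $\{a\in A: x_1a=\dots=x_ra=0\}$ has $k$-dimension one, and such that $h_j=\dim_k A_j$ for all $j\ge 0$, $h_1=r$, and $e$ is the largest index with $h_e\neq 0$. Fix integers $r\ge 1$ and $i\ge 0$. Then every Gorenstein $h$-vector $h$ of codimension $r$ and socle degree $$e>\frac{(i+1)(i+2)\cdots(i+r-1)}{(i+3)\,(r-1)!}+\frac32\, i$$ (the product in the numerator being $1$ if $r=1$) is unimodal up to degree $i+1$. That is, for every $j$ with $0\le j\le i$: if $2j+1\le e$ then $h_j\le h_{j+1}$, and if $2j+1\ge e$ then $h_{j+1}\le h_j$. In particular, if $e\ge 2i+1$, then $h_0\le h_1\le\dots\le h_{i+1}$. -/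

import Mathlib

open MvPolynomial

noncomputable section

/-- The degree `j` component `A_j` of the standard graded algebra `A = k[x_1, …, x_r] / I`:
the image in `A` of the homogeneous polynomials of degree `j`. -/
def gradedPiece {k : Type*} [Field k] {r : ℕ} (I : Ideal (MvPolynomial (Fin r) k)) (j : ℕ) :
    Submodule k (MvPolynomial (Fin r) k ⧸ I) :=
  (homogeneousSubmodule (Fin r) k j).map (Ideal.Quotient.mkₐ k I).toLinearMap

/-- The Hilbert function `j ↦ dim_k A_j` of `A = k[x_1, …, x_r] / I`. -/
def hilbertFn {k : Type*} [Field k] {r : ℕ} (I : Ideal (MvPolynomial (Fin r) k)) (j : ℕ) : ℕ :=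
  Module.finrank k (gradedPiece I j)

/-- The socle of `A = k[x_1, …, x_r] / I`: the elements of `A` that are annihilated by the
irrelevant maximal ideal `(x_1, …, x_r)`. -/
def socle {k : Type*} [Field k] {r : ℕ} (I : Ideal (MvPolynomial (Fin r) k)) :
    Submodule k (MvPolynomial (Fin r) k ⧸ I) where
  carrier := {a | ∀ s : Fin r, Ideal.Quotient.mk I (X s) * a = 0}
  zero_mem' := fun s => mul_zero _
  add_mem' := fun {a b} ha hb s => by
    rw [mul_add, ha s, hb s, add_zero]
  smul_mem' := fun c a ha s => by
    rw [mul_smul_comm, ha s, smul_zero]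

/-- `A = k[x_1, …, x_r] / I` is a standard graded artinian Gorenstein `k`-algebra: `I` is
homogeneous (it contains the homogeneous components of its elements), `A` is artinian, and the socle of `A` is one-dimensional over `k`. -/
structure IsArtinianGorenstein {k : Type*} [Field k] {r : ℕ}
    (I : Ideal (MvPolynomial (Fin r) k)) : Prop where
  homogeneous : ∀ f ∈ I, ∀ n : ℕ, homogeneousComponent n f ∈ I
  artinian : IsArtinianRing (MvPolynomial (Fin r) k ⧸ I)
  socle_dim : Module.finrank k (socle I) = 1

/-- `h = (h_0, h_1, …, h_e)`, extended by zero, is a Gorenstein `h`-vector over `k` of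
codimension `r` and socle degree `e`: it is the Hilbert function of an artinian Gorenstein
algebra `k[x_1, …, x_r] / I`, with `h_1 = r`, and `e` is the last degree in which it is
nonzero. -/
def IsGorensteinHVector (k : Type*) [Field k] (r e : ℕ) (h : ℕ → ℕ) : Prop :=
  ∃ I : Ideal (MvPolynomial (Fin r) k), IsArtinianGorenstein I ∧ (∀ j, h j = hilbertFn I j) ∧
    h 1 = r ∧ IsGreatest {j | h j ≠ 0} e

/-- Unimodality up to degree `d` for a Gorenstein `h`-vector of socle degree `e`. Such a vector
is symmetric about `e / 2`, so it is unimodal exactly when it does not decrease before `e / 2`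
and does not increase after `e / 2`; this is required here of all steps from `j` to `j + 1`
with `j + 1 ≤ d`. In particular, if `d ≤ (e + 1) / 2`, then `h_0 ≤ h_1 ≤ … ≤ h_d`. -/
def IsUnimodalUpTo (h : ℕ → ℕ) (e d : ℕ) : Prop :=
  ∀ j, j + 1 ≤ d → (2 * j + 1 ≤ e → h j ≤ h (j + 1)) ∧ (e ≤ 2 * j + 1 → h (j + 1) ≤ h j)

end

/-! Put `M = A_1`, so that `A_j = M ^ j`, and let `ℓ` be a general linear form. The socle pairing
gives `h_{e-j} = h_j` and makes multiplication by `ℓ` from `A_{e-j-1}` to `A_{e-j}` dual to that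
from `A_j` to `A_{j+1}`, so both have the same rank. Suppose `h_{j+1} < h_j` with `2j + 1 < e`, and
look at the Hilbert function of `A/ℓA`.

If it is at most `j + 1` in degree `j + 1`, Macaulay's bound (`finrank_pow_add_le_of_le`) makes it
nonincreasing from there on; comparing degrees `j + 1` and `e - j`, with equal ranks, gives `h_j ≤
h_{j+1}`. Otherwise it is at least `j + 3` in degree `e - j`, and Green's theorem
(`eventually_sum_min_le_finrank`) forces `2 h_j ≥ (j+3)(2e-3j)`. This contradicts the bound on `e`,
since `h_j` is at most the number of monomials of degree `j`.

Both growth theorems come from `eventually_min_finrank_le`, proved by comparing two general linear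
forms, without monomial ideals. -/

/-- The filter of sets in `kⁿ` that contain the nonvanishing locus of a nonzero polynomial. -/
def genericFilter (k : Type*) [Field k] (n : ℕ) : Filter (Fin n → k) where
  sets := {s | ∃ P : MvPolynomial (Fin n) k, P ≠ 0 ∧ ∀ v, eval v P ≠ 0 → v ∈ s}
  univ_sets := ⟨1, one_ne_zero, fun _ _ => trivial⟩
  sets_of_superset := fun ⟨P, h0, h⟩ hst => ⟨P, h0, fun v hv => hst (h v hv)⟩
  inter_sets := fun ⟨P, hP, h⟩ ⟨Q, hQ, h'⟩ => ⟨P * Q, mul_ne_zero hP hQ, fun v hv => by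
    rw [map_mul] at hv
    exact ⟨h v (left_ne_zero_of_mul hv), h' v (right_ne_zero_of_mul hv)⟩⟩

/-! ### Generic vectors and generic rank -/

section Generic

variable {k : Type*} [Field k] {n : ℕ}

lemma genericFilter_eventually_eval_ne_zero {P : MvPolynomial (Fin n) k} (hP : P ≠ 0) :
    ∀ᶠ v in genericFilter k n, eval v P ≠ 0 :=
  ⟨P, hP, fun _ hv => hv⟩

instance genericFilter_neBot [Infinite k] : (genericFilter k n).NeBot := by
  refine ⟨fun h => ?_⟩
  have h1 : (∅ : Set (Fin n → k)) ∈ genericFilter k n := by rw [h]; trivial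
  obtain ⟨P, hP, h⟩ := h1
  refine hP (MvPolynomial.funext fun v => ?_)
  by_contra hv
  exact h v (by simpa using hv)

/-- The linear form `∑ g(eₛ) Xₛ` representing the linear functional `g`. -/
noncomputable def linearFormOf (g : (Fin n → k) →ₗ[k] k) : MvPolynomial (Fin n) k :=
  ∑ s, C (g (Pi.single s 1)) * X s

lemma eval_linearFormOf (g : (Fin n → k) →ₗ[k] k) (v : Fin n → k) :
    eval v (linearFormOf g) = g v := by
  conv_rhs => rw [pi_eq_sum_univ' v, map_sum]
  simp [linearFormOf, mul_comm]

lemma genericFilter_eventually_apply_ne_zero {g : (Fin n → k) →ₗ[k] k} (hg : g ≠ 0) :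
    ∀ᶠ v in genericFilter k n, g v ≠ 0 := by
  have h : linearFormOf g ≠ 0 := fun h => hg (LinearMap.ext fun v => by
    rw [← eval_linearFormOf, h, map_zero, LinearMap.zero_apply])
  filter_upwards [genericFilter_eventually_eval_ne_zero h] with v hv
  rwa [eval_linearFormOf] at hv

variable {V Q : Type*} [AddCommGroup V] [Module k V] [AddCommGroup Q] [Module k Q]
  [FiniteDimensional k V]

/-- A maximal minor that is nonzero at `w` is a polynomial in `v`, hence nonzero generically. -/
lemma genericFilter_eventually_finrank_range_ge (F : (Fin n → k) →ₗ[k] V →ₗ[k] Q)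
    (w : Fin n → k) : ∀ᶠ v in genericFilter k n,
      Module.finrank k (LinearMap.range (F w)) ≤ Module.finrank k (LinearMap.range (F v)) := by
  classical
  set ρ := Module.finrank k (LinearMap.range (F w)) with hρ
  let b := Module.finBasis k (LinearMap.range (F w))
  have hx : ∀ i, ∃ x, F w x = b i := fun i => (b i).2
  choose x hx using hx
  have hb : LinearIndependent k fun i => (b i : Q) :=
    b.linearIndependent.map' (LinearMap.range (F w)).subtype (Submodule.ker_subtype _)
  obtain ⟨φ, hφ⟩ := LinearMap.exists_leftInverse_of_injective
    (Fintype.linearCombination k fun i => (b i : Q))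
    (LinearMap.ker_eq_bot.2 hb.fintypeLinearCombination_injective)
  let g : Fin ρ → Fin ρ → (Fin n → k) →ₗ[k] k := fun i j =>
    LinearMap.proj j ∘ₗ φ ∘ₗ (F.flip (x i))
  let D : Matrix (Fin ρ) (Fin ρ) (MvPolynomial (Fin n) k) :=
    Matrix.of fun i j => linearFormOf (g i j)
  have hD : ∀ v, eval v D.det = (Matrix.of fun i j => φ (F v (x i)) j).det := fun v => by
    rw [RingHom.map_det]
    congr 1
    ext i j
    simp [D, g, eval_linearFormOf]
  have hw : (Matrix.of fun i j => φ (F w (x i)) j) = 1 := by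
    ext i j
    have := congrArg (fun f => f j) (LinearMap.congr_fun hφ (Pi.single i 1))
    simp only [LinearMap.comp_apply, Fintype.linearCombination_apply_single, one_smul] at this
    rw [Matrix.of_apply, hx, this]
    simp [Matrix.one_apply, Pi.single_apply, eq_comm]
  have hD0 : D.det ≠ 0 := fun h => by
    have := hD w
    rw [h, hw] at this
    simp at this
  filter_upwards [genericFilter_eventually_eval_ne_zero hD0] with v hv
  rw [hD] at hv
  have h1 := Matrix.linearIndependent_rows_of_det_ne_zero hv
  have h2 : LinearIndependent k fun i => F v (x i) := LinearIndependent.of_comp φ h1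
  have h3 : LinearIndependent k
      fun i => (⟨F v (x i), x i, rfl⟩ : LinearMap.range (F v)) :=
    LinearIndependent.of_comp (LinearMap.range (F v)).subtype h2
  simpa using h3.fintype_card_le_finrank

lemma genericFilter_exists_eventually_finrank_range_eq [FiniteDimensional k Q]
    (F : (Fin n → k) →ₗ[k] V →ₗ[k] Q) :
    ∃ ρ, ∀ᶠ v in genericFilter k n, Module.finrank k (LinearMap.range (F v)) = ρ := by
  have hbdd : BddAbove (Set.range fun v => Module.finrank k (LinearMap.range (F v))) :=
    ⟨Module.finrank k Q, by rintro _ ⟨v, rfl⟩; exact Submodule.finrank_le _⟩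
  obtain ⟨w, hw⟩ := Nat.sSup_mem (Set.range_nonempty _) hbdd
  refine ⟨Module.finrank k (LinearMap.range (F w)), ?_⟩
  filter_upwards [genericFilter_eventually_finrank_range_ge F w] with v hv
  exact le_antisymm ((le_csSup hbdd ⟨v, rfl⟩).trans hw.ge) hv

end Generic

/-! ### Multiplication by a general linear form -/

section Algebra

variable {k A : Type*} [Field k] [CommRing A] [Algebra k A]

lemma span_singleton_mul_eq_map (a : A) (X : Submodule k A) :
    Submodule.span k {a} * X = X.map (LinearMap.mulLeft k a) := by
  ext y
  simp [Submodule.mem_span_singleton_mul]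

lemma finrank_map_mkQ_add_finrank [FiniteDimensional k A] (X E : Submodule k A) :
    Module.finrank k (X.map E.mkQ) + Module.finrank k E = Module.finrank k ↥(X ⊔ E) := by
  have h := ((E.mkQ).domRestrict (X ⊔ E)).finrank_range_add_finrank_ker
  have h1 : LinearMap.range ((E.mkQ).domRestrict (X ⊔ E)) = X.map E.mkQ := by
    rw [LinearMap.range_domRestrict, Submodule.map_sup, Submodule.mkQ_map_self, sup_bot_eq]
  have h2 : LinearMap.ker ((E.mkQ).domRestrict (X ⊔ E)) =
      E.comap (X ⊔ E).subtype := by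
    ext y; simp
  rw [h1, h2, (Submodule.comapSubtypeEquivOfLe (le_sup_right : E ≤ X ⊔ E)).finrank_eq] at h
  exact h

variable {n : ℕ} (ℓ : (Fin n → k) →ₗ[k] A)

/-- The condition is linear in `v`: a functional vanishing on `Y` but not on some `ℓ w * x` would be
nonzero on `ℓ v * x` for general `v`. -/
lemma range_mul_le_of_eventually [Infinite k] {X Y : Submodule k A}
    (h : ∀ᶠ v in genericFilter k n, Submodule.span k {ℓ v} * X ≤ Y) :
    LinearMap.range ℓ * X ≤ Y := by
  rw [Submodule.mul_le]
  rintro _ ⟨w, rfl⟩ x hx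
  by_contra hw
  obtain ⟨f, hf, hY⟩ := Submodule.exists_le_ker_of_notMem hw
  have hg : f ∘ₗ (LinearMap.mulRight k x) ∘ₗ ℓ ≠ 0 := fun h0 => hf (LinearMap.congr_fun h0 w)
  obtain ⟨v, hv, hv'⟩ := (h.and (genericFilter_eventually_apply_ne_zero hg)).exists
  exact hv' (hY (hv (Submodule.mul_mem_mul (Submodule.mem_span_singleton_self _) hx)))

lemma exists_eventually_finrank_eq [FiniteDimensional k A] (X E : Submodule k A) :
    ∃ ρ, ∀ᶠ v in genericFilter k n,
      Module.finrank k ↥(Submodule.span k {ℓ v} * X ⊔ E) = ρ := by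
  let F : (Fin n → k) →ₗ[k] X →ₗ[k] (A ⧸ E) :=
    (LinearMap.compRight k E.mkQ) ∘ₗ (LinearMap.lcomp k A X.subtype) ∘ₗ LinearMap.mul k A ∘ₗ ℓ
  obtain ⟨ρ, hρ⟩ := genericFilter_exists_eventually_finrank_range_eq F
  refine ⟨ρ + Module.finrank k E, ?_⟩
  filter_upwards [hρ] with v hv
  rw [← finrank_map_mkQ_add_finrank, span_singleton_mul_eq_map, ← hv]
  have h : ((X.map (LinearMap.mulLeft k (ℓ v))).map E.mkQ) = LinearMap.range (F v) := by
    ext y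
    simp [F]
  rw [h]

end Algebra

/-! ### Growth theorems of Macaulay and Green -/

section Multiplication

variable {k A : Type*} [Field k] [CommRing A] [Algebra k A] [FiniteDimensional k A]

/-- Rank-nullity for `X → A/E`, `x ↦ a * x`, whose kernel contains `K`. -/
lemma finrank_span_singleton_mul_sup_add_le (a : A) {X K E : Submodule k A} (hK : K ≤ X)
    (h : Submodule.span k {a} * K ≤ E) :
    Module.finrank k ↥(Submodule.span k {a} * X ⊔ E) + Module.finrank k K ≤
      Module.finrank k X + Module.finrank k E := by
  rw [← finrank_map_mkQ_add_finrank]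
  rw [span_singleton_mul_eq_map] at h ⊢
  have h1 := ((E.mkQ ∘ₗ LinearMap.mulLeft k a).domRestrict X).finrank_range_add_finrank_ker
  rw [LinearMap.range_domRestrict, Submodule.map_comp] at h1
  have h2 : K.comap X.subtype ≤
      LinearMap.ker ((E.mkQ ∘ₗ LinearMap.mulLeft k a).domRestrict X) := fun x hx => by
    have := h (Submodule.mem_map_of_mem hx)
    simpa using this
  have h3 := Submodule.finrank_mono h2
  rw [(Submodule.comapSubtypeEquivOfLe hK).finrank_eq] at h3
  omega

variable [Infinite k] {n : ℕ} (ℓ : (Fin n → k) →ₗ[k] A)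

/-- Multiplication by a general element of the space `M = range ℓ` has large rank modulo `E`. -/
lemma eventually_min_finrank_le (d : ℕ) (U E : Submodule k A) :
    ∀ᶠ v in genericFilter k n,
      min (Module.finrank k ↥(LinearMap.range ℓ ^ (d + 1) * U ⊔ E)) (Module.finrank k E + (d + 1)) ≤
        Module.finrank k ↥(Submodule.span k {ℓ v} * (LinearMap.range ℓ ^ d * U) ⊔ E) := by
  induction d generalizing U with
  | zero =>
    obtain ⟨ρ, hρ⟩ := exists_eventually_finrank_eq ℓ (LinearMap.range ℓ ^ 0 * U) E
    rcases Nat.lt_or_ge (Module.finrank k E) ρ with hlt | hge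
    · filter_upwards [hρ] with v hv
      rw [hv]
      exact (min_le_right _ _).trans hlt
    · have hM : LinearMap.range ℓ * (LinearMap.range ℓ ^ 0 * U) ≤ E := by
        refine range_mul_le_of_eventually ℓ ?_
        filter_upwards [hρ] with v hv
        have := Submodule.eq_of_le_of_finrank_le
          (le_sup_right : E ≤ Submodule.span k {ℓ v} * (LinearMap.range ℓ ^ 0 * U) ⊔ E)
          (hv.trans_le hge)
        rw [this]
        exact le_sup_left
      refine Filter.Eventually.of_forall fun v => (min_le_left _ _).trans ?_
      refine Submodule.finrank_mono (sup_le ?_ le_sup_right)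
      rw [pow_succ', mul_assoc]
      exact hM.trans le_sup_right
  | succ d ih =>
    set M := LinearMap.range ℓ with hMdef
    set X := M ^ (d + 1) * U with hX
    obtain ⟨ρ, hρ⟩ := exists_eventually_finrank_eq ℓ X E
    rcases Nat.lt_or_ge (Module.finrank k E + (d + 1)) ρ with hlt | hge
    · filter_upwards [hρ] with v hv
      rw [hv]
      exact (min_le_right _ _).trans hlt
    · filter_upwards [hρ] with v hv
      refine (min_le_left _ _).trans (Submodule.finrank_mono (sup_le ?_ le_sup_right))
      rw [pow_succ', mul_assoc]
      refine range_mul_le_of_eventually ℓ ?_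
      -- By induction, `ℓ w * ℓ v * M ^ d * U + E` already has dimension at least `ρ`. It lies in
      -- both `ℓ v * X + E` and `ℓ w * X + E`, of dimension `ρ`, so these coincide for general `w`.
      filter_upwards [hρ, ih (Submodule.span k {ℓ v} * U)] with w hw hvw
      have e1 : M ^ (d + 1) * (Submodule.span k {ℓ v} * U) = Submodule.span k {ℓ v} * X := by
        rw [hX]; ring
      rw [e1, hv, min_eq_left hge] at hvw
      set Z := Submodule.span k {ℓ w} * (M ^ d * (Submodule.span k {ℓ v} * U)) ⊔ E with hZ
      have hZv : Z ≤ Submodule.span k {ℓ v} * X ⊔ E := by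
        refine sup_le_sup_right ?_ E
        calc _ = Submodule.span k {ℓ v} * (Submodule.span k {ℓ w} * (M ^ d * U)) := by ring
          _ ≤ Submodule.span k {ℓ v} * (M * (M ^ d * U)) := by
            refine mul_le_mul' le_rfl (mul_le_mul' ?_ le_rfl)
            rw [Submodule.span_singleton_le_iff_mem]
            exact ⟨w, rfl⟩
          _ = _ := by rw [hX]; ring
      have hZw : Z ≤ Submodule.span k {ℓ w} * X ⊔ E := by
        refine sup_le_sup_right ?_ E
        calc _ = Submodule.span k {ℓ w} * (Submodule.span k {ℓ v} * (M ^ d * U)) := by ring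
          _ ≤ Submodule.span k {ℓ w} * (M * (M ^ d * U)) := by
            refine mul_le_mul' le_rfl (mul_le_mul' ?_ le_rfl)
            rw [Submodule.span_singleton_le_iff_mem]
            exact ⟨v, rfl⟩
          _ = _ := by rw [hX]; ring
      rw [← Submodule.eq_of_le_of_finrank_le hZv (hv.trans_le hvw),
        Submodule.eq_of_le_of_finrank_le hZw (hw.trans_le hvw)]
      exact le_sup_left

/-- Macaulay's theorem on the growth of Hilbert functions, in the range where the bound is
constant, for the quotient of `⨁ M ^ d` by `a ∈ M`. -/
lemma finrank_pow_add_le_of_le (v : Fin n → k) (d : ℕ)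
    (h : Module.finrank k ↥(LinearMap.range ℓ ^ (d + 1)) ≤
      Module.finrank k ↥(Submodule.span k {ℓ v} * LinearMap.range ℓ ^ d) + (d + 1)) :
    Module.finrank k ↥(LinearMap.range ℓ ^ (d + 2)) +
        Module.finrank k ↥(Submodule.span k {ℓ v} * LinearMap.range ℓ ^ d) ≤
      Module.finrank k ↥(LinearMap.range ℓ ^ (d + 1)) +
        Module.finrank k ↥(Submodule.span k {ℓ v} * LinearMap.range ℓ ^ (d + 1)) := by
  set M := LinearMap.range ℓ with hM
  have hv : Submodule.span k {ℓ v} ≤ M := by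
    rw [Submodule.span_singleton_le_iff_mem]; exact ⟨v, rfl⟩
  -- A general `ℓ w` maps `M ^ (d + 1)` modulo `ℓ v * M ^ d` to `M ^ (d + 2)` modulo `ℓ v * M ^ (d +
  -- 1)`. The source has dimension at most `d + 1 < d + 2`, so the minimum is the full target and
  -- the map is onto.
  obtain ⟨w, hw⟩ := (eventually_min_finrank_le ℓ (d + 1) 1
    (Submodule.span k {ℓ v} * M ^ (d + 1))).exists
  have hw' : Submodule.span k {ℓ w} ≤ M := by
    rw [Submodule.span_singleton_le_iff_mem]; exact ⟨w, rfl⟩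
  rw [← hM, mul_one, mul_one] at hw
  have h1 : Submodule.span k {ℓ v} * M ^ (d + 1) ≤ M ^ (d + 1 + 1) := by
    rw [pow_succ' M (d + 1)]
    exact mul_le_mul' hv le_rfl
  have hK : Submodule.span k {ℓ v} * M ^ d ≤ M ^ (d + 1) := by
    rw [pow_succ']
    exact mul_le_mul' hv le_rfl
  have h2 : Submodule.span k {ℓ w} * (Submodule.span k {ℓ v} * M ^ d) ≤
      Submodule.span k {ℓ v} * M ^ (d + 1) := by
    rw [mul_left_comm, pow_succ']
    exact mul_le_mul' le_rfl (mul_le_mul' hw' le_rfl)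
  have h3 := finrank_span_singleton_mul_sup_add_le (ℓ w) hK h2
  rw [sup_eq_left.2 h1] at hw
  rw [min_le_iff, show d + 1 + 1 = d + 2 from rfl] at hw
  omega

/-- Green's hyperplane restriction theorem: if a general hyperplane section of `⨁ M ^ d • U` has
dimension `m ≤ d + 2` in degree `d + 1`, then `M ^ (d + 1) * U` has dimension at least
`m + ⋯ + m + (m - 1) + ⋯ + 1`, a sum of `d + 2` terms. -/
lemma eventually_sum_min_le_finrank (d : ℕ) (U : Submodule k A) :
    ∀ᶠ v in genericFilter k n, ∑ j ∈ Finset.range (d + 2),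
      min (Module.finrank k ↥(LinearMap.range ℓ ^ (d + 1) * U) -
        Module.finrank k ↥(Submodule.span k {ℓ v} * (LinearMap.range ℓ ^ d * U))) (j + 1) ≤
      Module.finrank k ↥(LinearMap.range ℓ ^ (d + 1) * U) := by
  induction d generalizing U with
  | zero =>
    filter_upwards [eventually_min_finrank_le ℓ 0 U ⊥] with v hv
    rw [sup_bot_eq, sup_bot_eq, finrank_bot] at hv
    rw [Finset.sum_range_succ, Finset.sum_range_one]
    omega
  | succ d ih =>
    set M := LinearMap.range ℓ with hMdef
    set X := M ^ (d + 1) * U with hX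
    obtain ⟨ρ, hρ⟩ : ∃ ρ, ∀ᶠ v in genericFilter k n,
        Module.finrank k ↥(Submodule.span k {ℓ v} * X) = ρ := by
      obtain ⟨ρ, hρ⟩ := exists_eventually_finrank_eq ℓ X ⊥
      refine ⟨ρ, hρ.mono fun v hv => ?_⟩
      rwa [sup_bot_eq] at hv
    filter_upwards [hρ] with v hv
    obtain ⟨w, ⟨hw, hS⟩, hI⟩ := ((hρ.and (eventually_min_finrank_le ℓ (d + 1) U
      (Submodule.span k {ℓ v} * X))).and (ih (Submodule.span k {ℓ v} * U))).exists
    have hv' : Submodule.span k {ℓ v} ≤ M := by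
      rw [Submodule.span_singleton_le_iff_mem]; exact ⟨v, rfl⟩
    have hw' : Submodule.span k {ℓ w} ≤ M := by
      rw [Submodule.span_singleton_le_iff_mem]; exact ⟨w, rfl⟩
    have e1 : M ^ (d + 1) * (Submodule.span k {ℓ v} * U) = Submodule.span k {ℓ v} * X := by
      rw [hX]; ring
    rw [← hMdef, ← hX] at hS
    rw [e1, hv] at hI
    set Z := Submodule.span k {ℓ w} * (M ^ d * (Submodule.span k {ℓ v} * U)) with hZ
    have hZle : Z ≤ Submodule.span k {ℓ w} * X ⊓ Submodule.span k {ℓ v} * X := by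
      refine le_inf ?_ ?_
      · calc Z = Submodule.span k {ℓ w} * (Submodule.span k {ℓ v} * (M ^ d * U)) := by
              rw [hZ]; ring
          _ ≤ Submodule.span k {ℓ w} * (M * (M ^ d * U)) :=
            mul_le_mul' le_rfl (mul_le_mul' hv' le_rfl)
          _ = _ := by rw [hX]; ring
      · calc Z = Submodule.span k {ℓ v} * (Submodule.span k {ℓ w} * (M ^ d * U)) := by
              rw [hZ]; ring
          _ ≤ Submodule.span k {ℓ v} * (M * (M ^ d * U)) :=
            mul_le_mul' le_rfl (mul_le_mul' hw' le_rfl)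
          _ = _ := by rw [hX]; ring
    have hZr := Submodule.finrank_mono hZle
    have hsup := Submodule.finrank_sup_add_finrank_inf_eq
      (Submodule.span k {ℓ w} * X) (Submodule.span k {ℓ v} * X)
    have hvX : Submodule.span k {ℓ v} * X ≤ M ^ (d + 1 + 1) * U := by
      rw [pow_succ' M (d + 1), mul_assoc]
      exact mul_le_mul' hv' le_rfl
    have hρle := Submodule.finrank_mono hvX
    rw [sup_eq_left.2 hvX] at hS
    rw [hv, hw] at hsup
    rw [hv] at hS hρle ⊢
    set D := Module.finrank k ↥(M ^ (d + 1 + 1) * U)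
    -- The sum of `ℓ w * X` and `ℓ v * X` has dimension at most `2ρ - dim Z`, and at least `min D (ρ
    -- + d + 2)`. So passing from `U` to `ℓ v * U` does not shrink the section, up to truncation at
    -- `d + 2`, which the first `d + 2` summands do not see.
    have hm : min (D - ρ) (d + 2) ≤ ρ - Module.finrank k Z := by omega
    have hle : ∑ j ∈ Finset.range (d + 2), min (D - ρ) (j + 1) ≤ ρ := by
      refine le_trans (Finset.sum_le_sum fun j hj => ?_) hI
      have := Finset.mem_range.1 hj
      omega
    rw [Finset.sum_range_succ]
    have := min_le_left (D - ρ) (d + 2 + 1)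
    omega

end Multiplication

/-- An `m` by `N` rectangle minus a triangle of size `m(m-1)/2`. -/
lemma two_mul_sum_range_min_add (m N : ℕ) (h : m ≤ N + 1) :
    2 * ∑ t ∈ Finset.range N, min m (t + 1) + m * m = 2 * m * N + m := by
  induction N with
  | zero => interval_cases m <;> simp
  | succ N ih =>
    rw [Finset.sum_range_succ]
    rcases Nat.lt_or_ge (N + 1) m with hlt | hge
    · obtain rfl : m = N + 2 := by omega
      have h1 : ∀ M : ℕ, M ≤ N + 1 →
          2 * ∑ t ∈ Finset.range M, min (N + 2) (t + 1) = M * (M + 1) := by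
        intro M hM
        induction M with
        | zero => simp
        | succ M ihM =>
          rw [Finset.sum_range_succ, mul_add, ihM (by omega), min_eq_right (by omega)]
          ring
      have h2 := h1 N (by omega)
      rw [mul_add, h2, min_eq_right (by omega)]
      ring
    · have := ih hge
      rw [min_eq_left hge]
      linarith

/-! ### Perfect pairings and the numerical core -/

section Duality

variable {k A : Type*} [Field k] [CommRing A] [Algebra k A] [FiniteDimensional k A]

lemma finrank_le_finrank_of_pairing {V W : Type*} [AddCommGroup V] [Module k V] [AddCommGroup W]
    [Module k W] [FiniteDimensional k W] (f : V →ₗ[k] W →ₗ[k] k)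
    (h : ∀ x, x ≠ 0 → ∃ y, f x y ≠ 0) : Module.finrank k V ≤ Module.finrank k W := by
  rw [← Subspace.dual_finrank_eq (K := k) (V := W)]
  refine LinearMap.finrank_le_finrank_of_injective (f := f) ?_
  rw [← LinearMap.ker_eq_bot, LinearMap.ker_eq_bot']
  intro x hx
  by_contra h0
  obtain ⟨y, hy⟩ := h x h0
  exact hy (LinearMap.congr_fun hx y)

/-- The graded pieces `M ^ j`, `j ≤ e`, are dual to each other under `(a, b) ↦ φ (a * b)`. -/
def IsGradedPerfectPairing (M : Submodule k A) (φ : A →ₗ[k] k) (e : ℕ) : Prop :=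
  ∀ j ≤ e, ∀ a ∈ M ^ j, a ≠ 0 → ∃ b ∈ M ^ (e - j), φ (a * b) ≠ 0

namespace IsGradedPerfectPairing

variable {M : Submodule k A} {φ : A →ₗ[k] k} {e : ℕ}

lemma finrank_le (h : IsGradedPerfectPairing M φ e) {j : ℕ} (hj : j ≤ e) :
    Module.finrank k ↥(M ^ j) ≤ Module.finrank k ↥(M ^ (e - j)) := by
  refine finrank_le_finrank_of_pairing
    (((LinearMap.mul k A).compr₂ φ).domRestrict₁₂ (M ^ j) (M ^ (e - j))) fun x hx => ?_
  obtain ⟨b, hb, hne⟩ := h j hj x x.2 (by simpa using hx)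
  exact ⟨⟨b, hb⟩, hne⟩

lemma finrank_eq (h : IsGradedPerfectPairing M φ e) {j : ℕ} (hj : j ≤ e) :
    Module.finrank k ↥(M ^ (e - j)) = Module.finrank k ↥(M ^ j) := by
  refine le_antisymm ?_ (h.finrank_le hj)
  have := h.finrank_le (Nat.sub_le e j)
  rwa [Nat.sub_sub_self hj] at this

/-- The images are paired by `(a * c, a * b) ↦ φ (a * c * b)`. The section `s` chooses `b`; the
value depends only on `a * b`. -/
lemma finrank_span_singleton_mul_le (h : IsGradedPerfectPairing M φ e) {a : A} (ha : a ∈ M)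
    {j d : ℕ} (hj : d + 1 + j = e) :
    Module.finrank k ↥(Submodule.span k {a} * M ^ d) ≤
      Module.finrank k ↥(Submodule.span k {a} * M ^ j) := by
  let g : ↥(M ^ j) →ₗ[k] A := (LinearMap.mulLeft k a).domRestrict (M ^ j)
  have hg : Submodule.span k {a} * M ^ j = LinearMap.range g := by
    rw [span_singleton_mul_eq_map, LinearMap.range_domRestrict]
  rw [hg]
  obtain ⟨s, hs⟩ := g.rangeRestrict.exists_rightInverse_of_surjective g.range_rangeRestrict
  refine finrank_le_finrank_of_pairing
    ((((LinearMap.mul k A).compr₂ φ).domRestrict (Submodule.span k {a} * M ^ d)).compl₂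
      ((M ^ j).subtype ∘ₗ s)) fun x hx => ?_
  obtain ⟨x, hxm⟩ := x
  have hx0 : x ≠ 0 := by simpa using hx
  have hxM : x ∈ M ^ (d + 1) := by
    rw [pow_succ']
    have ha' : Submodule.span k {a} ≤ M := by rwa [Submodule.span_singleton_le_iff_mem]
    exact mul_le_mul' ha' le_rfl hxm
  obtain ⟨b, hb, hne⟩ := h (d + 1) (by omega) x hxM hx0
  rw [show e - (d + 1) = j by omega] at hb
  obtain ⟨c, -, rfl⟩ := Submodule.mem_span_singleton_mul.1 hxm
  refine ⟨g.rangeRestrict ⟨b, hb⟩, ?_⟩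
  have h1 := congrArg Subtype.val (LinearMap.congr_fun hs (g.rangeRestrict ⟨b, hb⟩))
  have h2 : a * (s (g.rangeRestrict ⟨b, hb⟩) : A) = a * b := h1
  have h3 : a * c * (s (g.rangeRestrict ⟨b, hb⟩) : A) = a * c * b := by
    linear_combination c * h2
  change φ (a * c * (s (g.rangeRestrict ⟨b, hb⟩) : A)) ≠ 0
  rwa [h3]

variable [Infinite k] {n : ℕ} {ℓ : (Fin n → k) →ₗ[k] A}

lemma finrank_pow_le_finrank_pow_succ (h : IsGradedPerfectPairing (LinearMap.range ℓ) φ e) {j : ℕ}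
    (hj : 2 * j + 1 ≤ e)
    (hlt : 2 * Module.finrank k ↥(LinearMap.range ℓ ^ j) + (j + 3) * (3 * j) <
      (j + 3) * (2 * e)) :
    Module.finrank k ↥(LinearMap.range ℓ ^ j) ≤ Module.finrank k ↥(LinearMap.range ℓ ^ (j + 1)) := by
  rcases hj.eq_or_lt with he | he
  · have := h.finrank_eq (j := j) (by omega)
    rw [show e - j = j + 1 by omega] at this
    exact this.ge
  obtain ⟨d, rfl⟩ : ∃ d, e = d + 1 + j := ⟨e - j - 1, by omega⟩
  -- Only Green's theorem needs `v` general; the duality of ranks and Macaulay's bound hold for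
  -- every `v`.
  obtain ⟨v, hv⟩ := (eventually_sum_min_le_finrank ℓ d 1).exists
  rw [mul_one, mul_one] at hv
  set M := LinearMap.range ℓ with hM
  have hrank := h.finrank_span_singleton_mul_le (a := ℓ v) ⟨v, rfl⟩ rfl
  have hsymm := h.finrank_eq (j := j) (by omega)
  rw [show d + 1 + j - j = d + 1 by omega] at hsymm
  by_contra! hcon
  rcases Nat.lt_or_ge (Module.finrank k ↥(Submodule.span k {ℓ v} * M ^ j) + (j + 1))
    (Module.finrank k ↥(M ^ (j + 1))) with hbig | hsmall
  · have hsum := two_mul_sum_range_min_add (j + 3) (d + 2) (by omega)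
    -- The `j + 3` is `j + 2` from `hbig` plus one from the strict drop `h_{j+1} < h_j`.
    have hle : ∑ t ∈ Finset.range (d + 2), min (j + 3) (t + 1) ≤
        Module.finrank k ↥(M ^ (d + 1)) :=
      le_trans (Finset.sum_le_sum fun t _ => min_le_min_right _ (by omega)) hv
    rw [hsymm] at hle
    nlinarith
  · have hmac : ∀ t, Module.finrank k ↥(M ^ (j + t + 1)) +
          Module.finrank k ↥(Submodule.span k {ℓ v} * M ^ j) ≤
        Module.finrank k ↥(Submodule.span k {ℓ v} * M ^ (j + t)) +
          Module.finrank k ↥(M ^ (j + 1)) := by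
      intro t
      induction t with
      | zero => rw [add_zero]; omega
      | succ t ih =>
        have := finrank_pow_add_le_of_le ℓ v (j + t) (by rw [← hM]; omega)
        rw [← hM, show j + t + 2 = j + (t + 1) + 1 by ring,
          show j + t + 1 = j + (t + 1) by ring] at this
        rw [show j + t + 1 = j + (t + 1) by ring] at ih
        omega
    have := hmac (d - j)
    rw [show j + (d - j) = d by omega] at this
    omega

end IsGradedPerfectPairing

end Duality

/-! ### Graded pieces and the socle pairing -/

section GradedPieces

variable {k : Type*} [Field k] {r : ℕ} (I : Ideal (MvPolynomial (Fin r) k))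

lemma gradedPiece_eq_pow (j : ℕ) : gradedPiece I j = gradedPiece I 1 ^ j := by
  rw [gradedPiece, gradedPiece, ← homogeneousSubmodule_one_pow]
  exact Submodule.map_pow _ _ _

/-- The map `v ↦ ∑ vₛ xₛ` onto the linear forms of `k[x₁, …, xᵣ] / I`. -/
noncomputable def linearFormMap : (Fin r → k) →ₗ[k] MvPolynomial (Fin r) k ⧸ I :=
  Fintype.linearCombination k fun s => Ideal.Quotient.mkₐ k I (X s)

lemma range_linearFormMap : LinearMap.range (linearFormMap I) = gradedPiece I 1 := by
  rw [linearFormMap, Fintype.range_linearCombination, gradedPiece,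
    homogeneousSubmodule_one_eq_span_X, Submodule.map_span, ← Set.range_comp]
  rfl

lemma mk_X_mem_gradedPiece_one (s : Fin r) : Ideal.Quotient.mk I (X s) ∈ gradedPiece I 1 :=
  ⟨X s, isHomogeneous_X k s, rfl⟩

lemma mul_mem_gradedPiece {a b : MvPolynomial (Fin r) k ⧸ I} {m n : ℕ}
    (ha : a ∈ gradedPiece I m) (hb : b ∈ gradedPiece I n) : a * b ∈ gradedPiece I (m + n) := by
  rw [gradedPiece_eq_pow] at ha hb ⊢
  have h := Submodule.mul_mem_mul ha hb
  rwa [← pow_add] at h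

lemma hilbertFn_le_multichoose (j : ℕ) : hilbertFn I j ≤ r.multichoose j := by
  classical
  let T := ((Finset.univ : Finset (Fin r)).finsuppAntidiag j).image
    fun d => Ideal.Quotient.mkₐ k I (monomial d 1)
  have hT : gradedPiece I j ≤ Submodule.span k (T : Set (MvPolynomial (Fin r) k ⧸ I)) := by
    rintro _ ⟨f, hf, rfl⟩
    have hf' : f.IsHomogeneous j := hf
    rw [f.as_sum, map_sum]
    refine Submodule.sum_mem _ fun d hd => ?_
    have hm : monomial d (coeff d f) = coeff d f • monomial d (1 : k) := by
      rw [smul_monomial, smul_eq_mul, mul_one]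
    rw [hm, map_smul]
    refine Submodule.smul_mem _ _ (Submodule.subset_span ?_)
    refine Finset.mem_coe.2 (Finset.mem_image.2 ⟨d, ?_, rfl⟩)
    rw [Finset.mem_finsuppAntidiag]
    refine ⟨?_, Finset.subset_univ _⟩
    rw [hf'.degree_eq_sum_deg_support hd]
    exact (Finset.sum_subset (Finset.subset_univ _) fun s _ hs => by simpa using hs).symm
  refine (Submodule.finrank_mono hT).trans ((finrank_span_finset_le_card T).trans ?_)
  refine Finset.card_image_le.trans ?_
  rw [Finset.card_finsuppAntidiag_nat_eq_multichoose, Finset.card_univ, Fintype.card_fin]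

variable {I}

lemma IsArtinianGorenstein.disjoint_gradedPiece (hI : IsArtinianGorenstein I) {m n : ℕ}
    (hmn : m ≠ n) : Disjoint (gradedPiece I m) (gradedPiece I n) := by
  rw [Submodule.disjoint_def]
  rintro _ ⟨f, hf, rfl⟩ ⟨g, hg, hgf⟩
  have h1 : f - g ∈ I := Ideal.Quotient.eq.1 hgf.symm
  have h2 := hI.homogeneous _ h1 m
  rw [map_sub, homogeneousComponent_of_mem hf, homogeneousComponent_of_mem hg, if_pos rfl,
    if_neg hmn, sub_zero] at h2
  exact Ideal.Quotient.eq_zero_iff_mem.2 h2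

lemma IsArtinianGorenstein.finiteDimensional (hI : IsArtinianGorenstein I) :
    FiniteDimensional k (MvPolynomial (Fin r) k ⧸ I) :=
  have := hI.artinian
  Module.finite_of_isArtinianRing k _

lemma IsArtinianGorenstein.gradedPiece_eq_bot (hI : IsArtinianGorenstein I) {e j : ℕ}
    (he : IsGreatest {j | hilbertFn I j ≠ 0} e) (hj : e < j) : gradedPiece I j = ⊥ := by
  have := hI.finiteDimensional
  by_contra h
  exact hj.not_ge (he.2 fun h0 => h (Submodule.finrank_eq_zero.1 h0))

lemma IsArtinianGorenstein.gradedPiece_eq_socle (hI : IsArtinianGorenstein I) {e : ℕ}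
    (he : IsGreatest {j | hilbertFn I j ≠ 0} e) : gradedPiece I e = socle I := by
  have := hI.finiteDimensional
  refine Submodule.eq_of_le_of_finrank_le (fun a ha s => ?_) ?_
  · have h := mul_mem_gradedPiece I (mk_X_mem_gradedPiece_one I s) ha
    rwa [hI.gradedPiece_eq_bot he (by omega), Submodule.mem_bot] at h
  · rw [hI.socle_dim]
    exact Nat.one_le_iff_ne_zero.2 he.1

/-- Below degree `e` a nonzero homogeneous element is outside the socle `A_e`, so some variable does
not kill it; iterate up to degree `e`. -/
lemma IsArtinianGorenstein.exists_mul_ne_zero (hI : IsArtinianGorenstein I) {e : ℕ}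
    (he : IsGreatest {j | hilbertFn I j ≠ 0} e) {j d : ℕ} (hj : j + d = e)
    {a : MvPolynomial (Fin r) k ⧸ I} (ha : a ∈ gradedPiece I j) (ha0 : a ≠ 0) :
    ∃ b ∈ gradedPiece I d, a * b ≠ 0 := by
  induction d generalizing j a with
  | zero =>
    refine ⟨1, ⟨1, isHomogeneous_one _ _, rfl⟩, ?_⟩
    rwa [mul_one]
  | succ d ih =>
    have hs : a ∉ socle I := fun hs => by
      rw [← hI.gradedPiece_eq_socle he] at hs
      exact ha0 (Submodule.disjoint_def.1 (hI.disjoint_gradedPiece (by omega)) a ha hs)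
    obtain ⟨s, hs⟩ : ∃ s : Fin r, Ideal.Quotient.mk I (X s) * a ≠ 0 := by
      by_contra! h
      exact hs h
    obtain ⟨b, hb, hne⟩ := ih (j := 1 + j) (by omega)
      (mul_mem_gradedPiece I (mk_X_mem_gradedPiece_one I s) ha) hs
    refine ⟨b * Ideal.Quotient.mk I (X s),
      mul_mem_gradedPiece I hb (mk_X_mem_gradedPiece_one I s), ?_⟩
    convert hne using 1
    ring

lemma IsArtinianGorenstein.exists_isGradedPerfectPairing (hI : IsArtinianGorenstein I) {e : ℕ}
    (he : IsGreatest {j | hilbertFn I j ≠ 0} e) :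
    ∃ φ : (MvPolynomial (Fin r) k ⧸ I) →ₗ[k] k,
      IsGradedPerfectPairing (LinearMap.range (linearFormMap I)) φ e := by
  obtain ⟨⟨y, hy⟩, hy0, hspan⟩ := finrank_eq_one_iff'.1 hI.socle_dim
  have hy0' : y ∉ (⊥ : Submodule k (MvPolynomial (Fin r) k ⧸ I)) := fun h =>
    hy0 (Subtype.ext ((Submodule.mem_bot k).1 h))
  -- As `A_e` is the line spanned by `y`, any functional with `φ y ≠ 0` is injective on it.
  obtain ⟨φ, hφ, -⟩ := Submodule.exists_le_ker_of_notMem hy0'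
  refine ⟨φ, fun j hj a ha ha0 => ?_⟩
  rw [range_linearFormMap, ← gradedPiece_eq_pow] at ha ⊢
  obtain ⟨b, hb, hne⟩ := hI.exists_mul_ne_zero he (Nat.add_sub_cancel' hj) ha ha0
  refine ⟨b, hb, ?_⟩
  have hab := mul_mem_gradedPiece I ha hb
  rw [Nat.add_sub_cancel' hj, hI.gradedPiece_eq_socle he] at hab
  obtain ⟨c, hc⟩ := hspan ⟨a * b, hab⟩
  have hc' : c • y = a * b := congrArg Subtype.val hc
  rw [← hc', map_smul, smul_eq_mul]
  refine mul_ne_zero (fun h0 => hne ?_) hφ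
  rw [← hc', h0, zero_smul]

end GradedPieces

/-! ### The numerical bound on the socle degree -/

section Bound

lemma prod_Icc_add_div_factorial (s j : ℕ) :
    (∏ t ∈ Finset.Icc 1 s, ((j : ℚ) + (t : ℚ))) / (Nat.factorial s : ℚ) =
      ((j + s).choose j : ℚ) := by
  have h1 : ∏ t ∈ Finset.Icc 1 s, (j + t) = (j + 1).ascFactorial s := by
    rw [Nat.ascFactorial_eq_prod_range, Finset.range_eq_Ico, Finset.prod_Ico_eq_prod_range,
      ← Finset.Ico_succ_right_eq_Icc, Finset.prod_Ico_eq_prod_range]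
    refine Finset.prod_congr (by simp) fun t _ => by omega
  rw [Nat.ascFactorial_eq_factorial_mul_choose, Nat.choose_symm_add.symm] at h1
  have h2 : ((∏ t ∈ Finset.Icc 1 s, (j + t) : ℕ) : ℚ) =
      (Nat.factorial s : ℚ) * ((j + s).choose j : ℚ) := by exact_mod_cast h1
  push_cast at h2
  rw [h2, mul_div_cancel_left₀ _ (by exact_mod_cast s.factorial_ne_zero)]

/-- Transfers the bound from `i` to every `j ≤ i`. For `s ≥ 1` the quotient itself is monotone; for
`s = 0` it decreases, but by less than the gain `3/2` of the linear term. -/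
lemma monotone_choose_div_add (s : ℕ) : Monotone fun j : ℕ =>
    ((j + s).choose j : ℚ) / ((j : ℚ) + 3) + (3 / 2 : ℚ) * (j : ℚ) := by
  refine monotone_nat_of_le_succ fun j => ?_
  have hc : ((j + s : ℕ) + 1 : ℚ) * ((j + s).choose j : ℚ) =
      ((j + 1 + s).choose (j + 1) : ℚ) * ((j : ℚ) + 1) := by
    have := Nat.add_one_mul_choose_eq (j + s) j
    rw [show j + s + 1 = j + 1 + s by ring] at this
    have h := congrArg (Nat.cast : ℕ → ℚ) this
    push_cast at h ⊢
    linarith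
  have hj : (0 : ℚ) ≤ j := j.cast_nonneg
  rcases s.eq_zero_or_pos with rfl | hs
  · simp only [add_zero, Nat.choose_self]
    have h1 : (1 : ℚ) / ((j : ℚ) + 3) ≤ 1 := by
      rw [div_le_one (by linarith)]; linarith
    have h2 : (0 : ℚ) ≤ 1 / (((j + 1 : ℕ) : ℚ) + 3) := by positivity
    push_cast at h2 ⊢
    linarith
  · have hs' : (1 : ℚ) ≤ s := by exact_mod_cast hs
    have hC : (0 : ℚ) ≤ ((j + s).choose j : ℚ) := Nat.cast_nonneg _
    have h1 : ((j + s).choose j : ℚ) / ((j : ℚ) + 3) ≤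
        ((j + 1 + s).choose (j + 1) : ℚ) / (((j + 1 : ℕ) : ℚ) + 3) := by
      rw [div_le_div_iff₀ (by positivity) (by positivity)]
      refine le_of_mul_le_mul_right ?_ (by linarith : (0 : ℚ) < (j : ℚ) + 1)
      push_cast at hc ⊢
      have h2 : ((j : ℚ) + 1 + 3) * ((j : ℚ) + 1) ≤ ((j : ℚ) + s + 1) * ((j : ℚ) + 3) := by
        nlinarith
      have h3 := mul_le_mul_of_nonneg_left h2 hC
      linear_combination h3 + ((j : ℚ) + 3) * hc
    push_cast at h1 ⊢
    linarith

lemma two_mul_multichoose_add_lt {r i e : ℕ} (hr : 1 ≤ r)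
    (he : (e : ℚ) > (∏ j ∈ Finset.Icc 1 (r - 1), ((i : ℚ) + (j : ℚ))) /
        (((i : ℚ) + 3) * (Nat.factorial (r - 1) : ℚ)) + (3 / 2 : ℚ) * (i : ℚ))
    {j : ℕ} (hj : j ≤ i) :
    2 * r.multichoose j + (j + 3) * (3 * j) < (j + 3) * (2 * e) := by
  obtain ⟨s, rfl⟩ : ∃ s, r = s + 1 := ⟨r - 1, by omega⟩
  rw [Nat.add_sub_cancel, mul_comm ((i : ℚ) + 3), ← div_div, prod_Icc_add_div_factorial] at he
  have h := (monotone_choose_div_add s hj).trans_lt he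
  rw [Nat.multichoose_eq, show s + 1 + j - 1 = j + s by omega]
  have hj3 : (0 : ℚ) < (j : ℚ) + 3 := by positivity
  have h1 : ((j + s).choose j : ℚ) / ((j : ℚ) + 3) < e - 3 / 2 * j := by linarith
  rw [div_lt_iff₀ hj3] at h1
  have h2 : (2 : ℚ) * ((j + s).choose j : ℚ) + (j + 3) * (3 * j) < (j + 3) * (2 * e) := by
    linarith
  exact_mod_cast h2

end Bound

theorem corollary2p6 {k : Type*} [Field k] [Infinite k] (r i : ℕ) (hr : 1 ≤ r)
    (e : ℕ) (h : ℕ → ℕ) (hG : IsGorensteinHVector k r e h)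
    (he : (e : ℚ) > (∏ j ∈ Finset.Icc 1 (r - 1), ((i : ℚ) + (j : ℚ))) /
        (((i : ℚ) + 3) * (Nat.factorial (r - 1) : ℚ)) + (3 / 2 : ℚ) * (i : ℚ)) :
    IsUnimodalUpTo h e (i + 1) := by
  obtain ⟨I, hI, hh, -, hmax⟩ := hG
  obtain rfl : h = hilbertFn I := funext hh
  have := hI.finiteDimensional
  obtain ⟨φ, hφ⟩ := hI.exists_isGradedPerfectPairing hmax
  have hpow : ∀ j, hilbertFn I j =
      Module.finrank k ↥(LinearMap.range (linearFormMap I) ^ j) := fun j => by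
    rw [range_linearFormMap, ← gradedPiece_eq_pow, hilbertFn]
  have hup : ∀ j, j ≤ i → 2 * j + 1 ≤ e → hilbertFn I j ≤ hilbertFn I (j + 1) := by
    intro j hj hje
    have hlt := two_mul_multichoose_add_lt hr he hj
    have hle := hilbertFn_le_multichoose I j
    rw [hpow] at hle
    rw [hpow, hpow]
    exact hφ.finrank_pow_le_finrank_pow_succ hje (by omega)
  have hsymm : ∀ j, j ≤ e → hilbertFn I (e - j) = hilbertFn I j := fun j hj => by
    rw [hpow, hpow]
    exact hφ.finrank_eq hj
  intro j hj
  refine ⟨hup j (by omega), fun hje => ?_⟩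
  rcases Nat.lt_or_ge j e with hlt | hge
  -- Symmetry reflects the step from `j` to `j + 1` into the one from `e - 1 - j` to `e - j`, and `e
  -- - 1 - j ≤ j ≤ i`.
  · have h1 := hup (e - 1 - j) (by omega) (by omega)
    have h2 := hsymm (j + 1) (by omega)
    have h3 := hsymm j hlt.le
    rw [show e - (j + 1) = e - 1 - j by omega] at h2
    rw [show e - j = e - 1 - j + 1 by omega] at h3
    omega
  · have h0 : hilbertFn I (j + 1) = 0 := by
      rw [hilbertFn, hI.gradedPiece_eq_bot hmax (by omega), finrank_bot]
    rw [h0]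
    exact Nat.zero_le _
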